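/- Let $n\ge 0$ and write a permutation $\pi$ of $[2n]=\{1,\dots,2n\}$ in one-line notation $\pi=\pi_1\pi_2\cdots\pi_{2n}$. Let $\mathfrak{G}^{\mathrm I}_{2n}$ be the set of permutations of $[2n]$ with no ascent $\pi_i<\pi_{i+1}$ in which $(\pi_i,\pi_{i+1})$ have parities (even, even), (even, odd) or (odd, odd); that is, every ascent $\pi_i<\pi_{i+1}$ has $\pi_i$ odd and $\pi_{i+1}$ even. Let $\mathfrak{D}_{2n}$ be the set of D-permutations, i.e. the permutations $\sigma$ of $[2n]$ with $\sigma_{2i}\le 2i$ and $\sigma_{2i-1}\ge 2i-1$ for all $i\in[n]$. Let $\mathrm{Lrmin}(\pi)$ be the set of left-to-right minima of $\pi$ (the letters $\pi_i$ with $\pi_i<\pi_j$ for all $j<i$), and let $\mathrm{Cmin}(\sigma)$ be the set of the smallest elements of the cycles of $\sigma$ (fixed points being cycles of length one). Define the map $\vartheta$ on permutations $\pi$ as follows. A cycle $(c_1\,c_2\cdots c_k)$ sends $c_i$ to $c_{i+1}$, indices modulo $k$. 1. Cut the word $\pi_1\cdots\pi_{2n}$ into blocks, starting a new block at every left-to-right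 minimum, regard each block as a cycle, and replace each cycle $(c_1\,c_2\cdots c_k)$ by $(c_1\,c_k\,c_{k-1}\cdots c_2)$. 2. In each resulting cycle $(c_1\cdots c_k)$ (whose minimum is $c_1$), call $c_i$ an even cyclic double ascent if $c_i$ is even and $c_{i-1}<c_i<c_{i+1}$, indices modulo $k$. Shift each even cyclic double ascent of this cycle, taken from right to left, rightwards until it is larger than its successor; a letter that reaches the right end stays there, its successor then being the minimum $c_1$. The product of the resulting cycles is the permutation $\vartheta(\pi)$. Then $\vartheta$ restricts to a bijection from $\mathfrak{G}^{\mathrm I}_{2n}$ onto $\mathfrak{D}_{2n}$, and for every $\pi\in\mathfrak{G}^{\mathrm I}_{2n}$, $$\mathrm{Lrmin}(\pi)=\mathrm{Cmin}(\vartheta(\pi)).$$ -/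

import Mathlib

namespace ParityPerm

variable {m : ℕ}

/-- A permutation `π` of `[m] = {1, …, m}` is a term of `Equiv.Perm (Fin m)`; the element
`i : Fin m` stands for the number `i + 1`, both as a position and as a letter. -/
def label (i : Fin m) : ℕ := (i : ℕ) + 1

/-- `π` has an ascent `π_i < π_{i+1}` whose bottom `π_i` satisfies `P` and whose top
`π_{i+1}` satisfies `Q`. -/
def HasAscentPattern (P Q : ℕ → Prop) (π : Equiv.Perm (Fin m)) : Prop :=
  ∃ i j : Fin m, label j = label i + 1 ∧ label (π i) < label (π j) ∧
    P (label (π i)) ∧ Q (label (π j))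

/-- The permutations of `[2n]` avoiding the parity patterns `eE`, `eO` and `oO`. -/
def GI (n : ℕ) : Set (Equiv.Perm (Fin (2 * n))) :=
  {π | ¬ HasAscentPattern Even Even π ∧ ¬ HasAscentPattern Even Odd π ∧
    ¬ HasAscentPattern Odd Odd π}

/-- The D-permutations of `[2n]`: `σ_{2i} ≤ 2i` and `σ_{2i-1} ≥ 2i-1`. -/
def DPerm (n : ℕ) : Set (Equiv.Perm (Fin (2 * n))) :=
  {σ | ∀ i, (Even (label i) → label (σ i) ≤ label i) ∧
    (Odd (label i) → label i ≤ label (σ i))}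

/-- The set of left-to-right minima (as letters) of the word `π_1 π_2 ⋯ π_m`. -/
def Lrmin (π : Equiv.Perm (Fin m)) : Set (Fin m) :=
  {a | ∃ i, π i = a ∧ ∀ j, j < i → π i < π j}

/-- The set of cycle minima of `σ`, where each fixed point is a cycle of length one. -/
def Cmin (σ : Equiv.Perm (Fin m)) : Set (Fin m) :=
  {a | ∀ b, σ.SameCycle a b → a ≤ b}

/-- Cut a word into blocks by starting a new block at every left-to-right minimum: the block
that starts with `a` goes on as long as the letters are larger than `a`. -/
def splitAtMinima : List (Fin m) → List (List (Fin m))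
  | [] => []
  | a :: l => (a :: l.takeWhile (fun b => decide (a < b))) ::
      splitAtMinima (l.dropWhile (fun b => decide (a < b)))
termination_by l => l.length
decreasing_by
  have h := (List.dropWhile_suffix (l := l) (fun b => decide (a < b))).length_le
  simp only [List.length_cons]
  omega

/-- `(c₁ c₂ ⋯ c_k)` becomes `(c₁ c_k c_{k-1} ⋯ c₂)`. -/
def reverseCycle : List (Fin m) → List (Fin m)
  | [] => []
  | a :: l => a :: l.reverse

/-- `x` is an even cyclic double ascent of the cycle `c = (c₁ ⋯ c_k)`: it is even, larger than
its cyclic predecessor and smaller than its cyclic successor. (`c.formPerm` sends every letter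
of `c` to its cyclic successor.) -/
def IsEvenCyclicDoubleAscent (c : List (Fin m)) (x : Fin m) : Prop :=
  c.formPerm.symm x < x ∧ x < c.formPerm x ∧ Even (label x)

instance (c : List (Fin m)) (x : Fin m) : Decidable (IsEvenCyclicDoubleAscent c x) :=
  inferInstanceAs (Decidable (_ ∧ _ ∧ _))

/-- Shift the letter `x`, standing in front of the word, to the right until it is larger than
its successor. If it reaches the right end it stays there: the words below are tails of cycles
written with their minimum first, so that the cyclic successor of the right end is the
minimum. -/
def shiftRight (x : Fin m) : List (Fin m) → List (Fin m)
  | [] => [x]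
  | y :: l => if y < x then x :: y :: l else y :: shiftRight x l

/-- Shift every even cyclic double ascent of the cycle `c`, taken from right to left. -/
def shiftCycle (c : List (Fin m)) : List (Fin m) :=
  c.foldr (fun x l => if IsEvenCyclicDoubleAscent c x then shiftRight x l else x :: l) []

/-- The permutation with the given cycle notation. -/
def ofCycles (cs : List (List (Fin m))) : Equiv.Perm (Fin m) :=
  (cs.map List.formPerm).prod

/-- Step (1), on cycle notation: cut the word `π_1 ⋯ π_m` at its left-to-right minima and
reverse every cycle. -/
def hatCycles (π : Equiv.Perm (Fin m)) : List (List (Fin m)) :=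
  (splitAtMinima (List.ofFn π)).map reverseCycle

/-- The map `ϑ`: step (1), followed by shifting the even cyclic double ascents in every cycle. -/
def vartheta (π : Equiv.Perm (Fin m)) : Equiv.Perm (Fin m) :=
  ofCycles ((hatCycles π).map shiftCycle)

end ParityPerm

namespace ParityPerm

variable {m : ℕ}

/-! On `GI n` the map `ϑ` acts on each block `a :: l` of the word by `blockMap`, giving `a ::
shiftEven l.reverse`. Here all even letters are shifted instead of only the even cyclic double
ascents; the extra shifts do nothing (`shiftCycle_eq`).

In the words of `GI n` and in the cycles of D-permutations alike, an even letter of a tail `l` is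
never followed in `l` by a larger one. On such blocks `blockMap` is an involution
(`blockMap_blockMap`), because shifting a letter commutes with inserting larger ones. The two kinds
of tail differ only in the odd letters: in a word each has a larger letter of the tail before it, in
a cycle after it. Reversal exchanges these conditions and `shiftEven` preserves both
(`OddAscending.shiftEven`, `isChain_odd_shiftEven`), so `blockMap` exchanges `WordBlock` and
`CycleBlock`.

Globally, `IsBlockList` describes both a word cut at its left-to-right minima and a normalized cycle
notation; each determines a permutation and is determined by it. Membership in `GI n` and in `DPerm
n` can be tested block by block. Since `blockMap` keeps first letters, which are the left-to-right
minima of the word and the minima of the cycles, the two sets of minima agree. -/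

/-! ### Shifting the even letters of a word. -/

/-- Put `x` in front of the word `l` and, if `x` is even, shift it to its place. -/
def insertEven (x : Fin m) (l : List (Fin m)) : List (Fin m) :=
  if Even (label x) then shiftRight x l else x :: l

/-- Shift all even letters of a word, taken from right to left. -/
def shiftEven (l : List (Fin m)) : List (Fin m) := l.foldr insertEven []

/-- The effect of `ϑ` on a block of the word `π`. -/
def blockMap : List (Fin m) → List (Fin m)
  | [] => []
  | a :: l => a :: shiftEven l.reverse

/-- Consecutive letters `x`, `y` of a word without ascents other than odd-even ones. -/
def WordStep (x y : Fin m) : Prop :=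
  (Even (label x) → y < x) ∧ (¬ Even (label y) → y < x)

@[simp] theorem shiftEven_nil : shiftEven ([] : List (Fin m)) = [] := rfl

theorem shiftEven_cons (x : Fin m) (l : List (Fin m)) :
    shiftEven (x :: l) = insertEven x (shiftEven l) := rfl

theorem shiftRight_perm (x : Fin m) (l : List (Fin m)) : (shiftRight x l).Perm (x :: l) := by
  induction l with
  | nil => simp [shiftRight]
  | cons y l ih =>
    unfold shiftRight
    split
    · rfl
    · exact (ih.cons y).trans (List.Perm.swap x y l)

theorem insertEven_perm (x : Fin m) (l : List (Fin m)) : (insertEven x l).Perm (x :: l) := by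
  unfold insertEven
  split
  · exact shiftRight_perm x l
  · rfl

theorem shiftEven_perm (l : List (Fin m)) : (shiftEven l).Perm l := by
  induction l with
  | nil => rfl
  | cons x l ih => exact (insertEven_perm x _).trans (ih.cons x)

theorem shiftRight_eq_cons {x : Fin m} {l : List (Fin m)} (h : ∀ y ∈ l.head?, y < x) :
    shiftRight x l = x :: l := by
  cases l with
  | nil => rfl
  | cons y l =>
    simp only [List.head?_cons, Option.mem_some_iff, forall_eq'] at h
    simp [shiftRight, h]

/-- In either order each letter lands before the first letter of `l` smaller than itself, and if
both land in the same gap then `y` precedes `x`. -/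
theorem shiftRight_comm {x y : Fin m} (h : x < y) (l : List (Fin m)) :
    shiftRight x (shiftRight y l) = shiftRight y (shiftRight x l) := by
  induction l with
  | nil => simp [shiftRight, h, h.not_gt]
  | cons z l ih =>
    by_cases hx : z < x
    · simp [shiftRight, hx, hx.trans h, h, h.not_gt]
    · by_cases hy : z < y
      · simp [shiftRight, hx, hy, h.not_gt]
      · simp [shiftRight, hx, hy, ih]

theorem shiftRight_insertEven {x y : Fin m} (h : x < y) (l : List (Fin m)) :
    shiftRight x (insertEven y l) = insertEven y (shiftRight x l) := by
  unfold insertEven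
  split
  · exact shiftRight_comm h l
  · simp [shiftRight, h.not_gt]

theorem shiftRight_foldl_insertEven {x : Fin m} (u : List (Fin m)) (hu : ∀ y ∈ u, x < y)
    (r : List (Fin m)) :
    shiftRight x (u.foldl (fun r y => insertEven y r) r) =
      u.foldl (fun r y => insertEven y r) (shiftRight x r) := by
  induction u generalizing r with
  | nil => rfl
  | cons y u ih =>
    simp only [List.mem_cons, forall_eq_or_imp] at hu
    simp only [List.foldl_cons]
    rw [ih hu.2, shiftRight_insertEven hu.1]

theorem exists_shiftRight_eq {x : Fin m} (l : List (Fin m)) (hx : x ∉ l) :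
    ∃ u v, l = u ++ v ∧ shiftRight x l = u ++ x :: v ∧ ∀ y ∈ u, x < y := by
  induction l with
  | nil => exact ⟨[], [], by simp [shiftRight]⟩
  | cons y l ih =>
    simp only [List.mem_cons, not_or] at hx
    by_cases hy : y < x
    · exact ⟨[], y :: l, by simp [shiftRight, hy]⟩
    · obtain ⟨u, v, h₁, h₂, h₃⟩ := ih hx.2
      refine ⟨y :: u, v, by simp [h₁], by simp [shiftRight, hy, h₂], ?_⟩
      simp only [List.mem_cons, forall_eq_or_imp]
      exact ⟨lt_of_le_of_ne (not_lt.1 hy) hx.1, h₃⟩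

/-- This is the inversion of `shiftEven`, generalized for induction: `r` stands for the reversed
letters already treated, so its head plays the predecessor of the head of `w`. -/
theorem foldl_insertEven_shiftEven (w r : List (Fin m)) (hw : w.Nodup)
    (h : w.IsChain fun x y => Even (label y) → x < y)
    (hr : ∀ x ∈ r.head?, ∀ y ∈ w.head?, Even (label y) → x < y) :
    (shiftEven w).foldl (fun r y => insertEven y r) r = w.reverse ++ r := by
  induction w generalizing r with
  | nil => rfl
  | cons x w ih =>
    rw [List.isChain_cons] at h
    rw [List.nodup_cons] at hw
    have ih' := ih (x :: r) hw.2 h.2 (by simpa using h.1)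
    rw [List.reverse_cons, List.append_assoc, List.singleton_append, ← ih', shiftEven_cons]
    by_cases hx : Even (label x)
    · obtain ⟨u, v, h₁, h₂, h₃⟩ := exists_shiftRight_eq (x := x) (shiftEven w)
        (fun hm => hw.1 ((shiftEven_perm w).mem_iff.1 hm))
      have hxr : shiftRight x r = x :: r := shiftRight_eq_cons fun y hy => hr y hy x (by simp) hx
      -- On its way right `x` passed only the larger letters `u`. Inserting `u` and then `x`
      -- therefore equals inserting `x` first, and `x` stays in front of `r`, whose head is smaller.
      rw [insertEven, if_pos hx, h₂, h₁, List.foldl_append, List.foldl_append, List.foldl_cons,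
        ← hxr, ← shiftRight_foldl_insertEven u h₃, insertEven, if_pos hx]
    · rw [insertEven, if_neg hx, List.foldl_cons, insertEven, if_neg hx]

theorem shiftEven_reverse_shiftEven {w : List (Fin m)} (hw : w.Nodup)
    (h : w.IsChain fun x y => Even (label y) → x < y) :
    shiftEven (shiftEven w).reverse = w.reverse := by
  have := foldl_insertEven_shiftEven w [] hw h (by simp)
  rw [List.append_nil] at this
  rw [← this, shiftEven, List.foldr_reverse]

theorem head?_shiftRight (x : Fin m) (l : List (Fin m)) :
    (shiftRight x l).head? = some x ∧ (∀ y ∈ l.head?, y < x) ∨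
      ∃ y ∈ l.head?, x ≤ y ∧ (shiftRight x l).head? = some y := by
  cases l with
  | nil => simp [shiftRight]
  | cons y l =>
    by_cases h : y < x
    · simp [shiftRight, h]
    · simp [shiftRight, h, not_lt.1 h]

theorem isChain_even_shiftEven {w : List (Fin m)} (hw : w.Nodup) :
    (shiftEven w).IsChain fun x y => Even (label x) → y < x := by
  induction w with
  | nil => simp
  | cons x w ih =>
    rw [List.nodup_cons, ← (shiftEven_perm w).mem_iff] at hw
    have hl := ih hw.2
    have hx := hw.1
    rw [shiftEven_cons]
    generalize shiftEven w = l at hl hx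
    by_cases he : Even (label x)
    · rw [insertEven, if_pos he]
      clear ih hw
      induction l with
      | nil => simp [shiftRight]
      | cons y l ih =>
        rw [List.mem_cons, not_or] at hx
        rw [List.isChain_cons] at hl
        by_cases hy : y < x
        · simp [shiftRight, hy, List.isChain_cons, hl]
          simpa using hl.1
        · rw [shiftRight, if_neg hy, List.isChain_cons]
          refine ⟨fun z hz hye => ?_, ih hl.2 hx.2⟩
          rcases head?_shiftRight x l with ⟨h, -⟩ | ⟨t, ht, -, h⟩
          · rw [h, Option.mem_some_iff] at hz
            exact hz ▸ lt_of_le_of_ne (not_lt.1 hy) hx.1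
          · rw [h, Option.mem_some_iff] at hz
            exact hl.1 z (hz ▸ ht) hye
    · rw [insertEven, if_neg he, List.isChain_cons]
      exact ⟨fun _ _ h => absurd h he, hl⟩

/-- The words in which every odd letter is followed by a larger one. -/
def OddAscending : List (Fin m) → Prop
  | [] => True
  | x :: l => (¬ Even (label x) → ∃ y ∈ l.head?, x < y) ∧ OddAscending l

theorem OddAscending.shiftRight {x : Fin m} (hx : Even (label x)) {l : List (Fin m)}
    (hl : OddAscending l) : OddAscending (shiftRight x l) := by
  induction l with
  | nil => simp [ParityPerm.shiftRight, OddAscending, hx]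
  | cons y l ih =>
    by_cases hy : y < x
    · rw [ParityPerm.shiftRight, if_pos hy]
      exact ⟨fun h => absurd hx h, hl⟩
    · rw [ParityPerm.shiftRight, if_neg hy]
      refine ⟨fun h => ?_, ih hl.2⟩
      obtain ⟨z, hz, hyz⟩ := hl.1 h
      rcases head?_shiftRight x l with ⟨h, h'⟩ | ⟨t, ht, -, h⟩
      · exact ⟨x, h, hyz.trans (h' z hz)⟩
      · exact ⟨t, h, by rwa [Option.mem_unique ht hz]⟩

/-- Only a letter that is at least `x` can be overtaken by `x`; hence shifting never lowers the head
of a word. -/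
theorem exists_head?_insertEven_ge (x : Fin m) (l : List (Fin m)) :
    ∃ y ∈ (insertEven x l).head?, x ≤ y := by
  unfold insertEven
  split
  · rcases head?_shiftRight x l with ⟨h, -⟩ | ⟨y, -, hxy, h⟩
    · exact ⟨x, h, le_rfl⟩
    · exact ⟨y, h, hxy⟩
  · exact ⟨x, rfl, le_rfl⟩

theorem OddAscending.shiftEven {w : List (Fin m)} (hw : OddAscending w) :
    OddAscending (shiftEven w) := by
  induction w with
  | nil => trivial
  | cons x w ih =>
    rw [shiftEven_cons]
    by_cases hx : Even (label x)
    · rw [insertEven, if_pos hx]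
      exact (ih hw.2).shiftRight hx
    · rw [insertEven, if_neg hx]
      refine ⟨fun _ => ?_, ih hw.2⟩
      obtain ⟨y, hy, hxy⟩ := hw.1 hx
      cases w with
      | nil => simp at hy
      | cons z w =>
        simp only [List.head?_cons, Option.mem_some_iff] at hy
        obtain ⟨t, ht, hzt⟩ := exists_head?_insertEven_ge z (ParityPerm.shiftEven w)
        exact ⟨t, ht, hxy.trans_le (hy ▸ hzt)⟩

/-- The condition on the last letter arises because an odd letter at the right end has no successor
inside the word. -/
theorem oddAscending_iff (w : List (Fin m)) : OddAscending w ↔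
    (w.IsChain fun x y => ¬ Even (label x) → x < y) ∧ ∀ x ∈ w.getLast?, Even (label x) := by
  induction w with
  | nil => simp [OddAscending]
  | cons x w ih =>
    cases w with
    | nil => simp [OddAscending]
    | cons y w =>
      rw [OddAscending, ih, List.isChain_cons_cons, List.getLast?_cons_cons]
      simp [and_assoc]

/-- An odd head does not move. An even head `x` yields its place only to some `t ≥ x`; were the next
letter odd, it would be `t` itself, yet smaller than `x`. So the next letter is even, and induction
gives that `t` is even. -/
theorem even_head?_shiftEven {w : List (Fin m)}
    (h : w.IsChain fun x y => ¬ Even (label y) → y < x) :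
    ∀ x ∈ w.head?, ∀ y ∈ (shiftEven w).head?, (Even (label x) ↔ Even (label y)) := by
  induction w with
  | nil => simp
  | cons x w ih =>
    rw [List.isChain_cons] at h
    simp only [List.head?_cons, Option.mem_some_iff, forall_eq']
    intro y hy
    rw [shiftEven_cons] at hy
    by_cases hx : Even (label x)
    · rw [insertEven, if_pos hx] at hy
      rcases head?_shiftRight x (shiftEven w) with ⟨h', -⟩ | ⟨t, ht, hxt, h'⟩
      · rw [h', Option.mem_some_iff] at hy
        rw [hy]
      · rw [h', Option.mem_some_iff] at hy
        subst hy
        cases w with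
        | nil => simp at ht
        | cons z w =>
          rw [← ih h.2 z rfl t ht]
          refine iff_of_true hx (not_not.1 fun hz => ?_)
          rw [shiftEven_cons, insertEven, if_neg hz, List.head?_cons, Option.mem_some_iff] at ht
          exact (h.1 z rfl hz).not_ge (ht ▸ hxt)
    · rw [insertEven, if_neg hx, List.head?_cons, Option.mem_some_iff] at hy
      rw [hy]

theorem isChain_odd_shiftEven {w : List (Fin m)}
    (h : w.IsChain fun x y => ¬ Even (label y) → y < x) :
    (shiftEven w).IsChain fun x y => ¬ Even (label y) → y < x := by
  induction w with
  | nil => simp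
  | cons x w ih =>
    rw [List.isChain_cons] at h
    have hl := ih h.2
    rw [shiftEven_cons]
    by_cases hx : Even (label x)
    · rw [insertEven, if_pos hx]
      generalize shiftEven w = l at hl
      clear ih
      induction l with
      | nil => simp [shiftRight]
      | cons y l ih =>
        rw [List.isChain_cons] at hl
        by_cases hy : y < x
        · rw [shiftRight, if_pos hy, List.isChain_cons, List.isChain_cons]
          refine ⟨fun z hz _ => ?_, hl⟩
          rw [List.head?_cons, Option.mem_some_iff] at hz
          exact hz ▸ hy
        · rw [shiftRight, if_neg hy, List.isChain_cons]
          refine ⟨fun z hz hze => ?_, ih hl.2⟩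
          rcases head?_shiftRight x l with ⟨h, -⟩ | ⟨t, ht, -, h⟩
          · rw [h, Option.mem_some_iff] at hz
            exact absurd (hz ▸ hx) hze
          · rw [h, Option.mem_some_iff] at hz
            exact hl.1 z (hz ▸ ht) hze
    · rw [insertEven, if_neg hx, List.isChain_cons]
      refine ⟨fun y hy hye => ?_, hl⟩
      cases w with
      | nil => simp at hy
      | cons z w =>
        -- An odd head after shifting comes from an odd head before, and an odd head has not moved,
        -- so `y = z`.
        have hz : ¬ Even (label z) := (even_head?_shiftEven h.2 z rfl y hy).not.2 hye
        rw [shiftEven_cons, insertEven, if_neg hz, List.head?_cons, Option.mem_some_iff] at hy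
        exact hy ▸ h.1 z rfl hz

/-! ### The block map exchanges word blocks and cycle blocks. -/

/-- What follows the minimum in a block of a word without ascents other than odd-even ones. -/
def WordTail (l : List (Fin m)) : Prop :=
  (l.IsChain fun x y => Even (label x) → y < x) ∧ OddAscending l.reverse

/-- What follows the minimum in a cycle of a D-permutation. -/
def CycleTail (l : List (Fin m)) : Prop :=
  (l.IsChain fun x y => Even (label x) → y < x) ∧ OddAscending l

/-- A block of a word without ascents other than odd-even ones. -/
def WordBlock : List (Fin m) → Prop
  | [] => True
  | a :: l => (l ≠ [] → ¬ Even (label a)) ∧ WordTail l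

/-- A cycle of a D-permutation, written with its minimum first. -/
def CycleBlock : List (Fin m) → Prop
  | [] => True
  | a :: l => (l ≠ [] → ¬ Even (label a)) ∧ CycleTail l

theorem shiftEven_reverse_perm (l : List (Fin m)) : (shiftEven l.reverse).Perm l :=
  (shiftEven_perm _).trans l.reverse_perm

theorem blockMap_perm (b : List (Fin m)) : (blockMap b).Perm b := by
  cases b with
  | nil => rfl
  | cons a l => exact (shiftEven_reverse_perm l).cons a

theorem head?_blockMap (b : List (Fin m)) : (blockMap b).head? = b.head? := by
  cases b <;> rfl

theorem shiftEven_reverse_involutive {l : List (Fin m)} (hl : l.Nodup)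
    (h : l.IsChain fun x y => Even (label x) → y < x) :
    shiftEven (shiftEven l.reverse).reverse = l := by
  rw [shiftEven_reverse_shiftEven (List.nodup_reverse.2 hl) (List.isChain_reverse.2 h),
    List.reverse_reverse]

theorem blockMap_blockMap {b : List (Fin m)} (hb : b.Nodup) (h : WordBlock b ∨ CycleBlock b) :
    blockMap (blockMap b) = b := by
  cases b with
  | nil => rfl
  | cons a l =>
    have h' : l.IsChain fun x y => Even (label x) → y < x :=
      h.elim (fun h => h.2.1) (fun h => h.2.1)
    simp only [blockMap]
    rw [shiftEven_reverse_involutive (List.nodup_cons.1 hb).2 h']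

theorem shiftEven_reverse_ne_nil {l : List (Fin m)} (h : shiftEven l.reverse ≠ []) : l ≠ [] := by
  rintro rfl
  exact h rfl

theorem WordBlock.cycleBlock_blockMap {b : List (Fin m)} (hb : b.Nodup) (h : WordBlock b) :
    CycleBlock (blockMap b) := by
  cases b with
  | nil => trivial
  | cons a l =>
    exact ⟨fun hl => h.1 (shiftEven_reverse_ne_nil hl),
      isChain_even_shiftEven (List.nodup_reverse.2 (List.nodup_cons.1 hb).2), h.2.2.shiftEven⟩

/-- The last letter of a cycle tail is even. It heads the reversed tail, and shifting keeps the
parity of the head, so the new tail begins with an even letter. -/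
theorem CycleBlock.wordBlock_blockMap {b : List (Fin m)} (hb : b.Nodup) (h : CycleBlock b) :
    WordBlock (blockMap b) := by
  cases b with
  | nil => trivial
  | cons a l =>
    refine ⟨fun hl => h.1 (shiftEven_reverse_ne_nil hl),
      isChain_even_shiftEven (List.nodup_reverse.2 (List.nodup_cons.1 hb).2), ?_⟩
    obtain ⟨h₁, h₂⟩ := (oddAscending_iff l).1 h.2.2
    have h₃ := List.isChain_reverse.2 h₁
    rw [oddAscending_iff, List.isChain_reverse, List.getLast?_reverse]
    refine ⟨isChain_odd_shiftEven h₃, fun x hx => ?_⟩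
    cases hl : l.reverse.head? with
    | none => simp_all
    | some y =>
      rw [← even_head?_shiftEven h₃ y hl x hx]
      exact h₂ y (by rwa [List.head?_reverse] at hl)

/-- The step from `a` into a nonempty tail is an ascent, so it forces `a` odd and the first tail
letter even; the latter is the last-letter condition for the reversed tail. -/
theorem isChain_wordStep_iff {a : Fin m} {l : List (Fin m)} (ha : ∀ x ∈ l, a < x) :
    (a :: l).IsChain WordStep ↔ WordBlock (a :: l) := by
  have key : l.IsChain WordStep ↔ (l.IsChain fun x y => Even (label x) → y < x) ∧
      l.IsChain fun x y => ¬ Even (label y) → y < x := by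
    clear ha
    simp only [List.isChain_iff_getElem, WordStep]
    exact ⟨fun h => ⟨fun i hi => (h i hi).1, fun i hi => (h i hi).2⟩,
      fun h i hi => ⟨h.1 i hi, h.2 i hi⟩⟩
  rw [List.isChain_cons, key]
  simp only [WordBlock, WordTail, oddAscending_iff, List.isChain_reverse, List.getLast?_reverse]
  cases l with
  | nil => simp
  | cons y l =>
    have hy : a < y := ha y (by simp)
    simp [WordStep, hy.not_gt]
    tauto

/-! ### Shifting only double ascents agrees with shifting all even letters. -/

theorem formPerm_apply_of_append {u v : List (Fin m)} {p x : Fin m}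
    (h : (u ++ p :: x :: v).Nodup) : (u ++ p :: x :: v).formPerm p = x := by
  have := List.formPerm_apply_lt_getElem _ h u.length (by simp)
  simpa using this

/-- Every even letter of `w` exceeds its predecessor, so it is a double ascent unless its successor
is smaller. A smaller successor inside `w` must be odd, hence stays in place, and the shift has no
effect. -/
theorem shiftCycle_eq {a : Fin m} {w : List (Fin m)} (hn : (a :: w).Nodup)
    (ha : w ≠ [] → ¬ Even (label a))
    (hc : (a :: w).IsChain fun x y => Even (label y) → x < y) :
    shiftCycle (a :: w) = a :: shiftEven w := by
  have key : ∀ v u p, a :: w = u ++ p :: v →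
      v.foldr (fun x l => if IsEvenCyclicDoubleAscent (a :: w) x then shiftRight x l else x :: l)
        [] = shiftEven v := by
    intro v
    induction v with
    | nil => intros; rfl
    | cons x v ih =>
      intro u p hv
      rw [List.foldr_cons, ih (u ++ [p]) x (by simp [hv]), shiftEven_cons, insertEven]
      by_cases hx : Even (label x)
      · rw [if_pos hx]
        split_ifs with hd
        · rfl
        · rw [shiftRight_eq_cons]
          have hpx : p < x := by
            rw [hv, List.isChain_append_cons_cons] at hc
            exact hc.2.1 hx
          have hp : (a :: w).formPerm.symm x = p := by
            rw [Equiv.symm_apply_eq]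
            rw [hv] at hn ⊢
            exact (formPerm_apply_of_append hn).symm
          cases v with
          | nil => simp
          | cons y v =>
            have hv' : a :: w = (u ++ [p]) ++ x :: y :: v := by simp [hv]
            have hy : (a :: w).formPerm x = y := by
              rw [hv'] at hn ⊢
              exact formPerm_apply_of_append hn
            have hxy : ¬ x < y := fun h => hd ⟨hp ▸ hpx, hy ▸ h, hx⟩
            rw [hv'] at hc hn
            have hye : ¬ Even (label y) :=
              fun h => hxy ((List.isChain_append_cons_cons.1 hc).2.1 h)
            have hne : x ≠ y := by
              rintro rfl
              simp [List.nodup_append] at hn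
            rw [shiftEven_cons, insertEven, if_neg hye]
            simpa using lt_of_le_of_ne (not_lt.1 hxy) hne.symm
      · rw [if_neg hx, if_neg fun h => hx h.2.2]
  rw [shiftCycle, List.foldr_cons, key w [] a rfl]
  -- The minimum `a` is never shifted: it is odd if `w` is nonempty, and otherwise it is a fixed
  -- point.
  rw [if_neg]
  rintro ⟨-, h₂, h₃⟩
  by_cases hw : w = []
  · subst hw
    simp at h₂
  · exact ha hw h₃

theorem shiftCycle_reverseCycle {a : Fin m} {l : List (Fin m)} (hn : (a :: l).Nodup)
    (ha : ∀ x ∈ l, a < x) (h : WordBlock (a :: l)) :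
    shiftCycle (reverseCycle (a :: l)) = blockMap (a :: l) := by
  refine shiftCycle_eq (((List.reverse_perm l).cons a).nodup_iff.2 hn) (fun hl => h.1 ?_) ?_
  · simpa using hl
  · rw [List.isChain_cons]
    refine ⟨fun y hy _ => ha y ?_, List.isChain_reverse.2 h.2.1⟩
    exact List.mem_reverse.1 (List.mem_of_mem_head? hy)

/-! ### The D-permutation condition along a cycle. -/

/-- The defining inequalities of a D-permutation at the position `x`. -/
def DAt (σ : Equiv.Perm (Fin m)) (x : Fin m) : Prop :=
  (Even (label x) → σ x ≤ x) ∧ (¬ Even (label x) → x ≤ σ x)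

/-- The last letter of `d` is sent to the smaller `a`, so it has to be even; this matches the demand
of `OddAscending` for a successor within `d`. -/
theorem forall_dAt_iff_cycleTail {σ : Equiv.Perm (Fin m)} {a : Fin m} {d : List (Fin m)}
    (hd : d.Nodup) (ha : ∀ x ∈ d, a < x) (h : (d ++ [a]).IsChain fun x y => σ x = y) :
    (∀ x ∈ d, DAt σ x) ↔ CycleTail d := by
  induction d with
  | nil => simp [CycleTail, OddAscending]
  | cons x d ih =>
    rw [List.cons_append, List.isChain_cons] at h
    rw [List.nodup_cons] at hd
    rw [List.forall_mem_cons, ih hd.2 (fun y hy => ha y (List.mem_cons_of_mem _ hy)) h.2]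
    have hx := ha x (by simp)
    cases d with
    | nil =>
      have : σ x = a := by simpa using h.1
      simp [CycleTail, OddAscending, DAt, this, hx.le, hx.not_ge]
    | cons y d =>
      have hy : σ x = y := by simpa using h.1
      have hne : x ≠ y := by
        rintro rfl
        simp at hd
      simp only [CycleTail, List.isChain_cons_cons, DAt, hy, OddAscending, List.head?_cons,
        Option.mem_some_iff, exists_eq_left', hne.le_iff_lt, hne.symm.le_iff_lt]
      tauto

theorem forall_dAt_iff_cycleBlock {σ : Equiv.Perm (Fin m)} {a : Fin m} {d : List (Fin m)}
    (hd : d.Nodup) (ha : ∀ x ∈ d, a < x) (h : (a :: d ++ [a]).IsChain fun x y => σ x = y) :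
    (∀ x ∈ a :: d, DAt σ x) ↔ CycleBlock (a :: d) := by
  rw [List.cons_append, List.isChain_cons] at h
  rw [List.forall_mem_cons, forall_dAt_iff_cycleTail hd ha h.2, CycleBlock]
  refine and_congr_left fun _ => ?_
  cases d with
  | nil =>
    have : σ a = a := by simpa using h.1
    simp [DAt, this]
  | cons y d =>
    have hy : σ a = y := by simpa using h.1
    have := ha y (by simp)
    simp [DAt, hy, this.le, this.not_ge]

/-! ### Block lists and the cutting of words at their minima. -/

/-- The first letter of the word `c` is larger than that of `d`. -/
def HeadGT (c d : List (Fin m)) : Prop := ∃ a ∈ c.head?, ∃ b ∈ d.head?, b < a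

theorem HeadGT.trans {b c d : List (Fin m)} (h₁ : HeadGT b c) (h₂ : HeadGT c d) : HeadGT b d := by
  obtain ⟨x, hx, y, hy, hxy⟩ := h₁
  obtain ⟨y', hy', z, hz, hyz⟩ := h₂
  cases Option.mem_unique hy hy'
  exact ⟨x, hx, z, hz, hyz.trans hxy⟩

theorem HeadGT.irrefl (c : List (Fin m)) : ¬ HeadGT c c := by
  rintro ⟨x, hx, y, hy, hxy⟩
  cases Option.mem_unique hx hy
  exact hxy.false

instance : Trans (HeadGT (m := m)) HeadGT HeadGT := ⟨HeadGT.trans⟩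

instance : Std.Irrefl (HeadGT (m := m)) := ⟨HeadGT.irrefl⟩

instance : Std.Antisymm (HeadGT (m := m)) := ⟨fun _ _ h₁ h₂ => ((h₁.trans h₂).irrefl).elim⟩

/-- A list of blocks, each starting with its smallest letter, with decreasing first letters,
in which every letter occurs exactly once. -/
structure IsBlockList (bs : List (List (Fin m))) : Prop where
  block : ∀ b ∈ bs, ∃ a l, b = a :: l ∧ ∀ x ∈ l, a < x
  pairwise : bs.Pairwise HeadGT
  nodup : bs.flatten.Nodup
  mem : ∀ x, x ∈ bs.flatten

theorem flatten_splitAtMinima (l : List (Fin m)) : (splitAtMinima l).flatten = l := by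
  induction l using splitAtMinima.induct with
  | case1 => simp [splitAtMinima]
  | case2 a l ih => rw [splitAtMinima, List.flatten_cons, ih]; simp

theorem block_splitAtMinima (l : List (Fin m)) :
    ∀ b ∈ splitAtMinima l, ∃ a t, b = a :: t ∧ ∀ x ∈ t, a < x := by
  induction l using splitAtMinima.induct with
  | case1 => simp [splitAtMinima]
  | case2 a l ih =>
    rw [splitAtMinima, List.forall_mem_cons]
    exact ⟨⟨a, _, rfl, fun x hx => by simpa using List.mem_takeWhile_imp hx⟩, ih⟩

theorem head?_splitAtMinima {l b : List (Fin m)} (hb : b ∈ (splitAtMinima l).head?) :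
    b.head? = l.head? := by
  cases l with
  | nil => simp [splitAtMinima] at hb
  | cons a l =>
    rw [splitAtMinima, List.head?_cons, Option.mem_some_iff] at hb
    rw [← hb]
    rfl

theorem isChain_splitAtMinima {l : List (Fin m)} (hl : l.Nodup) :
    (splitAtMinima l).IsChain HeadGT := by
  induction l using splitAtMinima.induct with
  | case1 => simp [splitAtMinima]
  | case2 a l ih =>
    rw [List.nodup_cons] at hl
    rw [splitAtMinima, List.isChain_cons]
    refine ⟨fun b hb => ?_, ih (hl.2.sublist (List.dropWhile_sublist _))⟩
    have hh := head?_splitAtMinima hb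
    obtain ⟨c, t, rfl, -⟩ := block_splitAtMinima _ b (List.mem_of_mem_head? hb)
    have hc := List.head?_dropWhile_not (fun b => decide (a < b)) l
    rw [← hh, List.head?_cons] at hc
    have hmem : c ∈ l := (List.dropWhile_sublist _).subset (List.mem_of_mem_head? hh.symm)
    refine ⟨a, rfl, c, rfl, lt_of_le_of_ne (by simpa using hc) ?_⟩
    rintro rfl
    exact hl.1 hmem

theorem isBlockList_splitAtMinima {l : List (Fin m)} (hl : l.Nodup) (h : ∀ x, x ∈ l) :
    IsBlockList (splitAtMinima l) where
  block := block_splitAtMinima l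
  pairwise := List.isChain_iff_pairwise.1 (isChain_splitAtMinima hl)
  nodup := by rwa [flatten_splitAtMinima]
  mem := by rwa [flatten_splitAtMinima]

theorem isBlockList_splitAtMinima_ofFn (π : Equiv.Perm (Fin m)) :
    IsBlockList (splitAtMinima (List.ofFn π)) :=
  isBlockList_splitAtMinima (List.nodup_ofFn.2 π.injective)
    fun x => (List.mem_ofFn' _ _).2 (π.surjective x)

theorem splitAtMinima_flatten {bs : List (List (Fin m))}
    (hb : ∀ b ∈ bs, ∃ a l, b = a :: l ∧ ∀ x ∈ l, a < x) (hp : bs.Pairwise HeadGT) :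
    splitAtMinima bs.flatten = bs := by
  induction bs with
  | nil => simp [splitAtMinima]
  | cons b bs ih =>
    rw [List.forall_mem_cons] at hb
    rw [List.pairwise_cons] at hp
    obtain ⟨⟨a, l, rfl, hl⟩, hb⟩ := hb
    have hl' : ∀ x ∈ l, decide (a < x) = true := by simpa using hl
    have hh : bs.flatten.takeWhile (fun b => decide (a < b)) = [] ∧
        bs.flatten.dropWhile (fun b => decide (a < b)) = bs.flatten := by
      cases bs with
      | nil => simp
      | cons c bs =>
        obtain ⟨x, t, rfl, -⟩ := hb c (by simp)
        obtain ⟨y, hy, z, hz, hyz⟩ := hp.1 _ List.mem_cons_self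
        simp only [List.head?_cons, Option.mem_some_iff] at hy hz
        subst hy hz
        simp [hyz.not_gt]
    rw [List.flatten_cons, List.cons_append, splitAtMinima, List.takeWhile_append_of_pos hl',
      List.dropWhile_append_of_pos hl', hh.1, hh.2, List.append_nil, ih hb hp.2]

theorem IsBlockList.exists_perm {bs : List (List (Fin m))} (h : IsBlockList bs) :
    ∃ π : Equiv.Perm (Fin m), List.ofFn π = bs.flatten := by
  have hlen : bs.flatten.length = m := by
    have h₁ := List.toFinset_card_of_nodup h.nodup
    have h₂ : bs.flatten.toFinset = Finset.univ := by
      ext x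
      simpa using h.mem x
    rw [← h₁, h₂, Finset.card_univ, Fintype.card_fin]
  let f : Fin m → Fin m := fun i => bs.flatten.get (i.cast hlen.symm)
  have hf : Function.Injective f := fun i j hij => by
    have := List.nodup_iff_injective_get.1 h.nodup hij
    simpa using this
  refine ⟨Equiv.ofBijective f (Finite.injective_iff_bijective.1 hf), ?_⟩
  apply List.ext_get
  · simp [hlen]
  · intro i h₁ h₂
    simp [f]

theorem IsBlockList.nodup_block {bs : List (List (Fin m))} (h : IsBlockList bs)
    {b : List (Fin m)} (hb : b ∈ bs) : b.Nodup :=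
  h.nodup.sublist (List.sublist_flatten_of_mem hb)

theorem IsBlockList.map_blockMap {bs : List (List (Fin m))} (h : IsBlockList bs) :
    IsBlockList (bs.map blockMap) := by
  have hp : (bs.map blockMap).flatten.Perm bs.flatten := by
    clear h
    induction bs with
    | nil => rfl
    | cons b bs ih => exact (blockMap_perm b).append ih
  refine ⟨fun c hc => ?_, ?_, hp.nodup_iff.2 h.nodup, fun x => hp.mem_iff.2 (h.mem x)⟩
  · obtain ⟨b, hb, rfl⟩ := List.mem_map.1 hc
    obtain ⟨a, l, rfl, hl⟩ := h.block b hb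
    exact ⟨a, _, rfl, fun x hx => hl x ((shiftEven_reverse_perm l).mem_iff.1 hx)⟩
  · rw [List.pairwise_map]
    exact h.pairwise.imp fun hbc => by simpa only [HeadGT, head?_blockMap] using hbc

/-! ### Permutations given by block lists of cycles. -/

theorem ofCycles_apply_of_notMem {cs : List (List (Fin m))} {x : Fin m} (hx : x ∉ cs.flatten) :
    ofCycles cs x = x := by
  induction cs with
  | nil => rfl
  | cons c cs ih =>
    rw [List.flatten_cons, List.mem_append, not_or] at hx
    have : ofCycles (c :: cs) x = c.formPerm (ofCycles cs x) := by simp [ofCycles]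
    rw [this, ih hx.2, List.formPerm_apply_of_notMem hx.1]

theorem ofCycles_apply {cs : List (List (Fin m))} (hcs : cs.flatten.Nodup) {c : List (Fin m)}
    (hc : c ∈ cs) {x : Fin m} (hx : x ∈ c) : ofCycles cs x = c.formPerm x := by
  induction cs with
  | nil => simp at hc
  | cons c' cs ih =>
    have h : ofCycles (c' :: cs) x = c'.formPerm (ofCycles cs x) := by simp [ofCycles]
    rw [List.flatten_cons, List.nodup_append'] at hcs
    rcases List.mem_cons.1 hc with rfl | hc
    · rw [h, ofCycles_apply_of_notMem fun hx' => hcs.2.2 hx hx']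
    · rw [h, ih hcs.2.1 hc, List.formPerm_apply_of_notMem]
      exact fun hx' => hcs.2.2 hx'
        (List.mem_flatten.2 ⟨c, hc, List.formPerm_apply_mem_of_mem hx⟩)

theorem isChain_formPerm {a : Fin m} {d : List (Fin m)} (h : (a :: d).Nodup) :
    (a :: d ++ [a]).IsChain fun x y => (a :: d).formPerm x = y := by
  rw [List.isChain_append]
  refine ⟨List.isChain_iff_getElem.2 fun i hi => List.formPerm_apply_lt_getElem _ h i hi,
    by simp, fun x hx y hy => ?_⟩
  rw [List.getLast?_eq_getLast_of_ne_nil (List.cons_ne_nil a d), Option.mem_some_iff] at hx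
  rw [List.head?_cons, Option.mem_some_iff] at hy
  rw [← hx, ← hy]
  exact List.formPerm_apply_getLast a d

theorem IsBlockList.isChain_ofCycles {cs : List (List (Fin m))} (h : IsBlockList cs) {a : Fin m}
    {d : List (Fin m)} (hc : a :: d ∈ cs) :
    (a :: d ++ [a]).IsChain fun x y => ofCycles cs x = y := by
  refine (isChain_formPerm (h.nodup_block hc)).imp_of_mem_imp fun x y hx _ hxy => ?_
  rw [ofCycles_apply h.nodup hc (by simpa [or_comm, or_assoc] using hx), hxy]

theorem IsBlockList.exists_mem {cs : List (List (Fin m))} (h : IsBlockList cs) (x : Fin m) :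
    ∃ a d, a :: d ∈ cs ∧ (∀ y ∈ d, a < y) ∧ x ∈ a :: d := by
  obtain ⟨c, hc, hx⟩ := List.mem_flatten.1 (h.mem x)
  obtain ⟨a, d, rfl, hd⟩ := h.block c hc
  exact ⟨a, d, hc, hd, hx⟩

theorem IsBlockList.lt_of_mem {cs : List (List (Fin m))} (h : IsBlockList cs) {a : Fin m}
    {d : List (Fin m)} (hc : a :: d ∈ cs) {x : Fin m} (hx : x ∈ d) : a < x := by
  obtain ⟨a', d', heq, hd⟩ := h.block _ hc
  cases heq
  exact hd x hx

theorem sameCycle_of_isChain {σ : Equiv.Perm (Fin m)} {a : Fin m} {d : List (Fin m)}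
    (h : (a :: d).IsChain fun x y => σ x = y) : ∀ x ∈ a :: d, σ.SameCycle a x := by
  induction d generalizing a with
  | nil => simp [Equiv.Perm.SameCycle.refl]
  | cons b d ih =>
    rw [List.isChain_cons_cons] at h
    rw [List.forall_mem_cons]
    refine ⟨.rfl, fun x hx => ?_⟩
    have hab : σ.SameCycle a b := ⟨1, by simpa using h.1⟩
    exact hab.trans (ih h.2 x hx)

theorem IsBlockList.mem_of_sameCycle {cs : List (List (Fin m))} (h : IsBlockList cs)
    {c : List (Fin m)} (hc : c ∈ cs) {x y : Fin m} (hx : x ∈ c)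
    (hxy : (ofCycles cs).SameCycle x y) : y ∈ c := by
  obtain ⟨i, rfl⟩ := hxy.exists_nat_pow_eq
  clear hxy
  induction i with
  | zero => exact hx
  | succ i ih =>
    rw [pow_succ', Equiv.Perm.mul_apply, ofCycles_apply h.nodup hc ih]
    exact List.formPerm_apply_mem_of_mem ih

theorem IsBlockList.mem_cmin_iff {cs : List (List (Fin m))} (h : IsBlockList cs) (a : Fin m) :
    a ∈ Cmin (ofCycles cs) ↔ ∃ d, a :: d ∈ cs := by
  constructor
  · intro ha
    obtain ⟨b, d, hc, hd, hab⟩ := h.exists_mem a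
    have hs := sameCycle_of_isChain (List.isChain_append.1 (h.isChain_ofCycles hc)).1 a hab
    rcases List.mem_cons.1 hab with rfl | hab
    · exact ⟨d, hc⟩
    · exact absurd (ha b hs.symm) (hd a hab).not_ge
  · rintro ⟨d, hc⟩ b hb
    rcases List.mem_cons.1 (h.mem_of_sameCycle hc (by simp) hb) with rfl | hbd
    · exact le_rfl
    · exact (h.lt_of_mem hc hbd).le

/-- Both lists follow the orbit of `x` under `σ` up to the first visit to `a`. -/
theorem eq_of_isChain {σ : Equiv.Perm (Fin m)} {a x : Fin m} {d d' : List (Fin m)}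
    (h : (x :: d ++ [a]).IsChain fun x y => σ x = y)
    (h' : (x :: d' ++ [a]).IsChain fun x y => σ x = y) (hd : a ∉ d) (hd' : a ∉ d') : d = d' := by
  induction d generalizing x d' with
  | nil =>
    cases d' with
    | nil => rfl
    | cons z d' =>
      simp only [List.cons_append, List.nil_append, List.isChain_cons_cons] at h h'
      simp [← h.1, ← h'.1] at hd'
  | cons y d ih =>
    cases d' with
    | nil =>
      simp only [List.cons_append, List.nil_append, List.isChain_cons_cons] at h h'
      simp [← h.1, ← h'.1] at hd
    | cons z d' =>
      rw [List.cons_append, List.cons_append, List.isChain_cons_cons] at h h'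
      obtain rfl : y = z := h.1.symm.trans h'.1
      rw [ih h.2 h'.2 (fun hm => hd (List.mem_cons_of_mem _ hm))
        (fun hm => hd' (List.mem_cons_of_mem _ hm))]

theorem IsBlockList.mem_of_ofCycles_eq {cs cs' : List (List (Fin m))} (h : IsBlockList cs)
    (h' : IsBlockList cs') (heq : ofCycles cs = ofCycles cs') {c : List (Fin m)} (hc : c ∈ cs) :
    c ∈ cs' := by
  obtain ⟨a, d, rfl, hd⟩ := h.block c hc
  obtain ⟨d', hc'⟩ := (h'.mem_cmin_iff a).1 (heq ▸ (h.mem_cmin_iff a).2 ⟨d, hc⟩)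
  have h₁ := h.isChain_ofCycles hc
  rw [heq] at h₁
  rw [eq_of_isChain h₁ (h'.isChain_ofCycles hc') (fun ha => (hd a ha).false)
    (fun ha => (h'.lt_of_mem hc' ha).false)]
  exact hc'

/-- The permutation determines the set of blocks, and the decreasing first letters determine their
order. -/
theorem IsBlockList.eq_of_ofCycles_eq {cs cs' : List (List (Fin m))} (h : IsBlockList cs)
    (h' : IsBlockList cs') (heq : ofCycles cs = ofCycles cs') : cs = cs' :=
  h.pairwise.eq_of_mem_iff h'.pairwise fun _ =>
    ⟨h.mem_of_ofCycles_eq h' heq, h'.mem_of_ofCycles_eq h heq.symm⟩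

theorem perm_eq_of_splitAtMinima_eq {π π' : Equiv.Perm (Fin m)}
    (h : splitAtMinima (List.ofFn π) = splitAtMinima (List.ofFn π')) : π = π' := by
  have := congrArg List.flatten h
  rw [flatten_splitAtMinima, flatten_splitAtMinima] at this
  exact DFunLike.coe_injective (List.ofFn_injective this)

/-- Reading the blocks of a word as cycles is an injective self-map of the finite set of
permutations, hence surjective. -/
theorem exists_isBlockList_ofCycles_eq (σ : Equiv.Perm (Fin m)) :
    ∃ cs, IsBlockList cs ∧ ofCycles cs = σ := by
  have hinj : Function.Injective
      fun π : Equiv.Perm (Fin m) => ofCycles (splitAtMinima (List.ofFn π)) := fun π π' h =>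
    perm_eq_of_splitAtMinima_eq ((isBlockList_splitAtMinima_ofFn π).eq_of_ofCycles_eq
      (isBlockList_splitAtMinima_ofFn π') h)
  obtain ⟨π, hπ⟩ := Finite.surjective_of_injective hinj σ
  exact ⟨_, isBlockList_splitAtMinima_ofFn π, hπ⟩

/-! ### Blockwise descriptions of both sets, of `ϑ` and of the minima. -/

theorem mem_dPerm_iff {n : ℕ} {σ : Equiv.Perm (Fin (2 * n))} : σ ∈ DPerm n ↔ ∀ x, DAt σ x := by
  simp only [DPerm, Set.mem_ofPred_eq, DAt, Nat.not_even_iff_odd, label, Nat.add_le_add_iff_right,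
    Fin.val_fin_le]

theorem IsBlockList.ofCycles_mem_dPerm_iff {n : ℕ} {cs : List (List (Fin (2 * n)))}
    (h : IsBlockList cs) : ofCycles cs ∈ DPerm n ↔ ∀ c ∈ cs, CycleBlock c := by
  have key : ∀ a d, a :: d ∈ cs →
      ((∀ x ∈ a :: d, DAt (ofCycles cs) x) ↔ CycleBlock (a :: d)) := fun a d hc =>
    forall_dAt_iff_cycleBlock (List.nodup_cons.1 (h.nodup_block hc)).2
      (fun x hx => h.lt_of_mem hc hx) (h.isChain_ofCycles hc)
  rw [mem_dPerm_iff]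
  constructor
  · intro hD c hc
    obtain ⟨a, d, rfl, -⟩ := h.block c hc
    exact (key a d hc).1 fun x _ => hD x
  · intro hC x
    obtain ⟨a, d, hc, -, hx⟩ := h.exists_mem x
    exact (key a d hc).2 (hC _ hc) x hx

theorem mem_GI_iff {n : ℕ} {π : Equiv.Perm (Fin (2 * n))} :
    π ∈ GI n ↔ (List.ofFn π).IsChain WordStep := by
  have hstep : ∀ x y : Fin (2 * n), x ≠ y → (WordStep x y ↔
      ¬ (label x < label y ∧ Even (label x) ∧ Even (label y)) ∧
      ¬ (label x < label y ∧ Even (label x) ∧ Odd (label y)) ∧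
      ¬ (label x < label y ∧ Odd (label x) ∧ Odd (label y))) := by
    intro x y hxy
    have h₁ : label x < label y ↔ ¬ y < x := by
      rw [not_lt, hxy.le_iff_lt]
      simp [label]
    rw [h₁, ← Nat.not_even_iff_odd, ← Nat.not_even_iff_odd, WordStep]
    tauto
  have hne : ∀ i j : Fin (2 * n), label j = label i + 1 → π i ≠ π j := by
    intro i j hij h
    rw [π.injective h] at hij
    omega
  have hchain : (List.ofFn π).IsChain WordStep ↔
      ∀ i j : Fin (2 * n), label j = label i + 1 → WordStep (π i) (π j) := by
    rw [List.isChain_iff_getElem]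
    constructor
    · intro h i j hij
      have hj : (j : ℕ) = i + 1 := by simpa [label] using hij
      have := h i (by simp [← hj])
      simpa [← hj] using this
    · intro h i hi
      have hi' : i + 1 < 2 * n := by simpa using hi
      simpa using h ⟨i, by omega⟩ ⟨i + 1, hi'⟩ rfl
  rw [hchain]
  simp only [GI, HasAscentPattern, Set.mem_ofPred_eq, not_exists, not_and]
  constructor
  · rintro ⟨h₁, h₂, h₃⟩ i j hij
    rw [hstep _ _ (hne i j hij)]
    exact ⟨fun h => h₁ i j hij h.1 h.2.1 h.2.2, fun h => h₂ i j hij h.1 h.2.1 h.2.2,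
      fun h => h₃ i j hij h.1 h.2.1 h.2.2⟩
  · intro h
    have h' := fun i j hij => (hstep _ _ (hne i j hij)).1 (h i j hij)
    exact ⟨fun i j hij a b c => (h' i j hij).1 ⟨a, b, c⟩,
      fun i j hij a b c => (h' i j hij).2.1 ⟨a, b, c⟩,
      fun i j hij a b c => (h' i j hij).2.2 ⟨a, b, c⟩⟩

/-- Junctions between blocks impose nothing: the last letter of a block is at least its minimum,
which exceeds the next minimum. -/
theorem IsBlockList.isChain_flatten_iff {bs : List (List (Fin m))} (h : IsBlockList bs) :
    bs.flatten.IsChain WordStep ↔ ∀ b ∈ bs, WordBlock b := by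
  have hnil : [] ∉ bs := fun hm => by
    obtain ⟨a, l, hb, -⟩ := h.block _ hm
    simp at hb
  rw [List.isChain_flatten hnil]
  have hj : bs.IsChain fun l₁ l₂ => ∀ᵉ (x ∈ l₁.getLast?) (y ∈ l₂.head?), WordStep x y := by
    refine (List.isChain_iff_pairwise.2 h.pairwise).imp_of_mem_imp ?_
    rintro b c hb - ⟨a, ha, z, hz, hza⟩ x hx y hy
    cases Option.mem_unique hz hy
    obtain ⟨a', l, rfl, hl⟩ := h.block b hb
    obtain rfl : a' = a := by simpa using ha
    have hax : a' ≤ x := by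
      rcases List.mem_cons.1 (List.mem_of_mem_getLast? hx) with rfl | hx
      · exact le_rfl
      · exact (hl x hx).le
    exact ⟨fun _ => hza.trans_le hax, fun _ => hza.trans_le hax⟩
  refine (and_iff_left hj).trans (forall₂_congr fun b hb => ?_)
  obtain ⟨a, l, rfl, hl⟩ := h.block b hb
  exact isChain_wordStep_iff hl

theorem mem_GI_iff_wordBlock {n : ℕ} {π : Equiv.Perm (Fin (2 * n))} :
    π ∈ GI n ↔ ∀ b ∈ splitAtMinima (List.ofFn π), WordBlock b := by
  rw [mem_GI_iff, ← (isBlockList_splitAtMinima_ofFn π).isChain_flatten_iff, flatten_splitAtMinima]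

theorem vartheta_eq {n : ℕ} {π : Equiv.Perm (Fin (2 * n))} (hπ : π ∈ GI n) :
    vartheta π = ofCycles ((splitAtMinima (List.ofFn π)).map blockMap) := by
  have h := isBlockList_splitAtMinima_ofFn π
  rw [vartheta, hatCycles, List.map_map]
  congr 1
  refine List.map_congr_left fun b hb => ?_
  have hw := mem_GI_iff_wordBlock.1 hπ b hb
  have hn := h.nodup_block hb
  obtain ⟨a, l, rfl, hl⟩ := h.block b hb
  exact shiftCycle_reverseCycle hn hl hw

theorem IsBlockList.mem_lrmin_iff {bs : List (List (Fin m))} (h : IsBlockList bs)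
    {π : Equiv.Perm (Fin m)} (hπ : List.ofFn π = bs.flatten) (a : Fin m) :
    a ∈ Lrmin π ↔ ∃ l, a :: l ∈ bs := by
  have key : a ∈ Lrmin π ↔ ∃ u v, bs.flatten = u ++ a :: v ∧ ∀ y ∈ u, a < y := by
    rw [← hπ]
    constructor
    · rintro ⟨i, rfl, hi⟩
      refine ⟨(List.ofFn π).take i, (List.ofFn π).drop (i + 1), ?_, fun y hy => ?_⟩
      · have := List.drop_eq_getElem_cons (l := List.ofFn π) (i := i) (by simp)
        rw [List.getElem_ofFn] at this
        rw [← this, List.take_append_drop]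
      · obtain ⟨j, hj, rfl⟩ := List.mem_take_iff_getElem.1 hy
        simp only [List.getElem_ofFn]
        exact hi _ (by simp [Fin.lt_def]; omega)
    · rintro ⟨u, v, huv, hu⟩
      have hlen : u.length < m := by
        have := congrArg List.length huv
        simp at this
        omega
      have hget : ∀ j : Fin m, (List.ofFn π)[(j : ℕ)]? = some (π j) := fun j => by simp
      have ha : π ⟨u.length, hlen⟩ = a := by
        have := hget ⟨u.length, hlen⟩
        rw [huv] at this
        simpa using this.symm
      refine ⟨⟨u.length, hlen⟩, ha, fun j hj => ?_⟩
      rw [ha]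
      have hju : (j : ℕ) < u.length := hj
      have := hget j
      rw [huv, List.getElem?_append_left hju] at this
      exact hu _ (List.mem_of_getElem? this)
  rw [key]
  constructor
  · rintro ⟨u, v, huv, hu⟩
    obtain ⟨b, l, hb, hl, hab⟩ := h.exists_mem a
    rcases List.mem_cons.1 hab with rfl | hal
    · exact ⟨l, hb⟩
    · exfalso
      obtain ⟨bs₁, bs₂, rfl⟩ := List.append_of_mem hb
      obtain ⟨l₁, l₂, rfl⟩ := List.append_of_mem hal
      have hn := h.nodup
      have e : (bs₁ ++ (b :: (l₁ ++ a :: l₂)) :: bs₂).flatten =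
          (bs₁.flatten ++ b :: l₁) ++ a :: (l₂ ++ bs₂.flatten) := by simp
      rw [e] at huv hn
      -- The letter `a` lies in neither prefix, so the two factorizations coincide. Then `b`
      -- precedes `a` and is smaller, a contradiction.
      have hu' : bs₁.flatten ++ b :: l₁ = u := by
        have h₁ : a ∉ bs₁.flatten ++ b :: l₁ := fun hm =>
          (List.nodup_append'.1 hn).2.2 hm (by simp)
        have h₂ : a ∉ u := fun hm => (hu a hm).false
        rw [List.append_eq_append_iff] at huv
        rcases huv with ⟨t, ht, hs⟩ | ⟨t, ht, hs⟩
        · cases t with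
          | nil => simpa using ht.symm
          | cons z t =>
            simp only [List.cons_append, List.cons.injEq] at hs
            exact absurd (by simp [ht, hs.1]) h₂
        · cases t with
          | nil => simpa using ht
          | cons z t =>
            simp only [List.cons_append, List.cons.injEq] at hs
            exact absurd (by simp [ht, hs.1]) h₁
      exact (hu b (by simp [← hu'])).not_gt (hl a hal)
  · rintro ⟨l, hb⟩
    obtain ⟨bs₁, bs₂, rfl⟩ := List.append_of_mem hb
    refine ⟨bs₁.flatten, l ++ bs₂.flatten, by simp, fun y hy => ?_⟩
    obtain ⟨c, hc, hyc⟩ := List.mem_flatten.1 hy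
    obtain ⟨z, t, rfl, ht⟩ := h.block c (by simp [hc])
    obtain ⟨z', hz', a', ha', haz⟩ := (List.pairwise_append.1 h.pairwise).2.2 _ hc _
      List.mem_cons_self
    obtain rfl : z = z' := by simpa using hz'
    obtain rfl : a = a' := by simpa using ha'
    rcases List.mem_cons.1 hyc with rfl | hyt
    · exact haz
    · exact haz.trans (ht y hyt)

/-! ### Equality of the minima and bijectivity. -/

theorem lrmin_eq_cmin_vartheta {n : ℕ} {π : Equiv.Perm (Fin (2 * n))} (hπ : π ∈ GI n) :
    Lrmin π = Cmin (vartheta π) := by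
  have h := isBlockList_splitAtMinima_ofFn π
  ext a
  rw [h.mem_lrmin_iff (flatten_splitAtMinima _).symm, vartheta_eq hπ, h.map_blockMap.mem_cmin_iff]
  constructor
  · rintro ⟨l, hl⟩
    exact ⟨_, List.mem_map_of_mem hl⟩
  · rintro ⟨d, hd⟩
    obtain ⟨b, hb, hbd⟩ := List.mem_map.1 hd
    have hh := head?_blockMap b
    obtain ⟨a', l, rfl, -⟩ := h.block b hb
    obtain rfl : a = a' := by simpa [hbd] using hh
    exact ⟨l, hb⟩

theorem mapsTo_vartheta (n : ℕ) : Set.MapsTo vartheta (GI n) (DPerm n) := by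
  intro π hπ
  have h := isBlockList_splitAtMinima_ofFn π
  rw [vartheta_eq hπ, h.map_blockMap.ofCycles_mem_dPerm_iff, List.forall_mem_map]
  exact fun b hb => (mem_GI_iff_wordBlock.1 hπ b hb).cycleBlock_blockMap (h.nodup_block hb)

theorem injOn_vartheta (n : ℕ) : Set.InjOn vartheta (GI n) := by
  intro π hπ π' hπ' heq
  have h := isBlockList_splitAtMinima_ofFn π
  have h' := isBlockList_splitAtMinima_ofFn π'
  rw [vartheta_eq hπ, vartheta_eq hπ'] at heq
  have key : ∀ π ∈ GI n, ((splitAtMinima (List.ofFn π)).map blockMap).map blockMap =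
      splitAtMinima (List.ofFn π) := fun π hπ => by
    rw [List.map_map]
    exact (List.map_congr_left fun b hb => blockMap_blockMap
      ((isBlockList_splitAtMinima_ofFn π).nodup_block hb)
      (.inl (mem_GI_iff_wordBlock.1 hπ b hb))).trans (List.map_id _)
  apply perm_eq_of_splitAtMinima_eq
  rw [← key π hπ, ← key π' hπ', h.map_blockMap.eq_of_ofCycles_eq h'.map_blockMap heq]

theorem surjOn_vartheta (n : ℕ) : Set.SurjOn vartheta (GI n) (DPerm n) := by
  intro σ hσ
  obtain ⟨cs, hcs, rfl⟩ := exists_isBlockList_ofCycles_eq σ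
  rw [hcs.ofCycles_mem_dPerm_iff] at hσ
  -- The preimage is the word obtained by applying the involution `blockMap` to the cycles of `σ`
  -- and concatenating.
  obtain ⟨π, hπ⟩ := hcs.map_blockMap.exists_perm
  have hs : splitAtMinima (List.ofFn π) = cs.map blockMap := by
    rw [hπ, splitAtMinima_flatten hcs.map_blockMap.block hcs.map_blockMap.pairwise]
  have hGI : π ∈ GI n := by
    rw [mem_GI_iff_wordBlock, hs, List.forall_mem_map]
    exact fun c hc => (hσ c hc).wordBlock_blockMap (hcs.nodup_block hc)
  refine ⟨π, hGI, ?_⟩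
  rw [vartheta_eq hGI, hs, List.map_map]
  congr 1
  exact (List.map_congr_left fun c hc =>
    blockMap_blockMap (hcs.nodup_block hc) (.inr (hσ c hc))).trans (List.map_id _)

end ParityPerm

theorem theorem4p7 (n : ℕ) :
    Set.BijOn (ParityPerm.vartheta (m := 2 * n)) (ParityPerm.GI n) (ParityPerm.DPerm n) ∧
      ∀ π ∈ ParityPerm.GI n, ParityPerm.Lrmin π = ParityPerm.Cmin (ParityPerm.vartheta π) :=
  ⟨⟨ParityPerm.mapsTo_vartheta n, ParityPerm.injOn_vartheta n, ParityPerm.surjOn_vartheta n⟩,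
    fun _ hπ => ParityPerm.lrmin_eq_cmin_vartheta hπ⟩
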